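/- **Definitions.** For a group $G$, let $\operatorname{Sub}(G)$ be the set of all subgroups of $G$ with the Chabauty topology, that is, the topology induced by the inclusion $\operatorname{Sub}(G)\subset\{0,1\}^G$, where $\{0,1\}^G$ has the product topology. A subgroup of $G$ is *isolated* if it is an isolated point of $\operatorname{Sub}(G)$, and $G$ is *solitary* if the isolated subgroups are dense in $\operatorname{Sub}(G)$. The group $G$ is *LERF* if every finitely generated subgroup of $G$ is an intersection of finite index subgroups of $G$. **Theorem.** 1. Every finitely generated LERF group is solitary. 2. If $G$ is a group such that $\operatorname{Sub}(G)$ is countable, then $G$ is solitary. 3. Let $1\to N\to H\to G\to 1$ be a short exact sequence of countable groups such that $N$ is finitely generated as an abstract group. If $H$ is solitary, then $G$ is solitary. 4. Let $G$ and $H$ be countable groups. The free product $G*H$ is solitary if and only if one of the following holds: * both $G$ and $H$ are finitely generated and LERF; * $G$ is solitary and $H$ is trivial, or $H$ is solitary and $G$ is trivial. -/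

import Mathlib

universe u v w

/-- The Chabauty topology on the set of subgroups of a (discrete) group: the topology induced from
the product topology on `{0,1}^G` by sending a subgroup to its indicator function. -/
noncomputable instance chabautyTopology (G : Type*) [Group G] : TopologicalSpace (Subgroup G) :=
  open Classical in
  TopologicalSpace.induced (fun (K : Subgroup G) (g : G) => (decide (g ∈ K) : Bool))
    Pi.topologicalSpace

/-- The set `Is(G)` of isolated points of the space of subgroups of `G`. -/
def isolatedSubgroups (G : Type*) [Group G] : Set (Subgroup G) :=
  {K | IsOpen ({K} : Set (Subgroup G))}

/-- A group is solitary if the isolated subgroups are dense in the space of all subgroups. -/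
def IsSolitary (G : Type*) [Group G] : Prop :=
  Dense (isolatedSubgroups G)

/-- A group is LERF (subgroup separable) if every finitely generated subgroup is an intersection
of finite index subgroups. -/
def IsLERF (G : Type*) [Group G] : Prop :=
  ∀ K : Subgroup G, K.FG →
    ∃ S : Set (Subgroup G), (∀ L ∈ S, L.FiniteIndex) ∧ K = sInf S

/-! Basic neighbourhoods of `K` consist of the subgroups agreeing with `K` on a finite set, so `K`
is isolated when finitely many membership conditions determine it. In a finitely generated group
finite index subgroups are isolated, and LERF makes them dense. For countably many subgroups, Baire
category in a compact Hausdorff space suffices. For quotients, approximants containing the finitely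
generated kernel descend.

For free products of nontrivial groups, a subgroup is viewed as the stabilizer of a point under a
pair of actions on one set. If `K` is isolated, a finite piece of its coset action already
determines the whole action; comparison with modified actions and twisted covers then forces the
index to be finite (`IsRigidAt.finite`). Density of such subgroups makes the free product finitely
generated and LERF, and both properties pass to the factors. The converse is `IsLERF.coprod`, which
glues finite models of the two actions. -/

/-! ### The Chabauty topology, LERF groups, countable case and quotients. -/

section Chabauty

variable {G : Type*} [Group G]

/-- Two subgroups agree on a set if they contain the same elements of it. -/
def AgreeOn (S : Set G) (K L : Subgroup G) : Prop :=
  ∀ s ∈ S, s ∈ K ↔ s ∈ L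

theorem isClopen_setOf_mem (s : G) : IsClopen {K : Subgroup G | s ∈ K} := by
  classical
  have hc : Continuous (fun K : Subgroup G => (decide (s ∈ K) : Bool)) := by
    have h : Continuous (fun (K : Subgroup G) (g : G) => (decide (g ∈ K) : Bool)) := by
      convert continuous_induced_dom
    exact (continuous_apply s).comp h
  have := (isClopen_discrete ({true} : Set Bool)).preimage hc
  convert this using 1
  ext K
  simp

theorem isOpen_setOf_agreeOn {S : Set G} (hS : S.Finite) (K : Subgroup G) :
    IsOpen {L | AgreeOn S L K} := by
  have : {L | AgreeOn S L K} = ⋂ s ∈ S, {L : Subgroup G | s ∈ L ↔ s ∈ K} := by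
    ext L
    simp [AgreeOn]
  rw [this]
  refine hS.isOpen_biInter fun s _ => ?_
  by_cases hs : s ∈ K
  · simpa [hs] using (isClopen_setOf_mem s).isOpen
  · simp only [hs, iff_false]
    exact (isClopen_setOf_mem s).compl.isOpen

theorem Subgroup.isOpen_iff_agreeOn {U : Set (Subgroup G)} :
    IsOpen U ↔ ∀ K ∈ U, ∃ S : Set G, S.Finite ∧ ∀ L, AgreeOn S L K → L ∈ U := by
  classical
  constructor
  · intro hU K hK
    obtain ⟨V, hV, rfl⟩ := isOpen_induced_iff.1 hU
    obtain ⟨I, u, hu, hI⟩ := isOpen_pi_iff.1 hV _ hK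
    refine ⟨I, I.finite_toSet, fun L hL => hI fun i hi => ?_⟩
    have h := (hu i hi).2
    have e : (i ∈ L) = (i ∈ K) := propext (hL i hi)
    simpa only [e] using h
  · intro h
    refine isOpen_iff_forall_mem_open.2 fun K hK => ?_
    obtain ⟨S, hS, hSU⟩ := h K hK
    exact ⟨_, hSU, isOpen_setOf_agreeOn hS K, fun _ _ => Iff.rfl⟩

theorem mem_isolatedSubgroups_iff {K : Subgroup G} :
    K ∈ isolatedSubgroups G ↔ ∃ S : Set G, S.Finite ∧ ∀ L, AgreeOn S L K → L = K := by
  simp [isolatedSubgroups, Subgroup.isOpen_iff_agreeOn]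

theorem isSolitary_iff_agreeOn :
    IsSolitary G ↔ ∀ (K : Subgroup G) (S : Set G), S.Finite →
      ∃ L ∈ isolatedSubgroups G, AgreeOn S L K := by
  constructor
  · intro h K S hS
    obtain ⟨L, hL, hL'⟩ := h.inter_open_nonempty _ (isOpen_setOf_agreeOn hS K)
      ⟨K, fun _ _ => Iff.rfl⟩
    exact ⟨L, hL', hL⟩
  · intro h
    refine dense_iff_inter_open.2 fun U hU ⟨K, hK⟩ => ?_
    obtain ⟨S, hS, hSU⟩ := Subgroup.isOpen_iff_agreeOn.1 hU K hK
    obtain ⟨L, hL, hLK⟩ := h K S hS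
    exact ⟨L, hSU L hLK, hL⟩

theorem fg_of_mem_isolatedSubgroups {K : Subgroup G} (hK : K ∈ isolatedSubgroups G) : K.FG := by
  obtain ⟨S, hS, h⟩ := mem_isolatedSubgroups_iff.1 hK
  rw [Subgroup.fg_iff]
  refine ⟨S ∩ K, h _ fun s hs => ⟨fun hsc => ?_, fun hsK => Subgroup.subset_closure ⟨hs, hsK⟩⟩,
    hS.inter_of_left _⟩
  exact (Subgroup.closure_le K).2 Set.inter_subset_right hsc

/-- Agreement on generators of `K` forces `K ≤ L`, so `L` is a union of cosets of `K`; testing one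
representative per coset excludes all but `K` itself. -/
theorem mem_isolatedSubgroups_of_finiteIndex [Group.FG G] (K : Subgroup G) [K.FiniteIndex] :
    K ∈ isolatedSubgroups G := by
  obtain ⟨T, hT, hTfin⟩ :=
    (Subgroup.fg_iff K).1 ((Group.fg_iff_subgroup_fg K).1 inferInstance)
  refine mem_isolatedSubgroups_iff.2
    ⟨T ∪ Set.range (Quotient.out : G ⧸ K → G), hTfin.union (@Set.finite_range _ _ _ (inferInstanceAs (Finite (G ⧸ K)))), fun L hL => ?_⟩
  have hKL : K ≤ L := by
    rw [← hT, Subgroup.closure_le]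
    intro t ht
    exact (hL t (Or.inl ht)).2 (hT ▸ Subgroup.subset_closure ht)
  refine le_antisymm (fun m hm => ?_) hKL
  have hr : (Quotient.out (m : G ⧸ K))⁻¹ * m ∈ K :=
    QuotientGroup.eq.1 (QuotientGroup.out_eq' (m : G ⧸ K))
  have hrL : Quotient.out (m : G ⧸ K) ∈ L := by
    have := L.mul_mem hm (L.inv_mem (hKL hr))
    simpa using this
  have := K.mul_mem ((hL _ (Or.inr ⟨_, rfl⟩)).1 hrL) hr
  simpa using this

theorem isLERF_iff_forall_notMem :
    IsLERF G ↔ ∀ K : Subgroup G, K.FG → ∀ x ∉ K, ∃ L : Subgroup G, L.FiniteIndex ∧ K ≤ L ∧ x ∉ L := by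
  constructor
  · intro h K hK x hx
    obtain ⟨S, hS, rfl⟩ := h K hK
    rw [Subgroup.mem_sInf] at hx
    push Not at hx
    obtain ⟨L, hL, hxL⟩ := hx
    exact ⟨L, hS L hL, sInf_le hL, hxL⟩
  · intro h K hK
    refine ⟨{L | L.FiniteIndex ∧ K ≤ L}, fun L hL => hL.1,
      le_antisymm (le_sInf fun L hL => hL.2) fun x hx => ?_⟩
    by_contra hxK
    obtain ⟨L, hL, hKL, hxL⟩ := h K hK x hxK
    exact hxL (Subgroup.mem_sInf.1 hx L ⟨hL, hKL⟩)

/-- Intersect finitely many finite index subgroups containing `S ∩ K`, one excluding each element of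
`S \ K`. -/
theorem IsLERF.isSolitary [Group.FG G] (hG : IsLERF G) : IsSolitary G := by
  rw [isLERF_iff_forall_notMem] at hG
  refine isSolitary_iff_agreeOn.2 fun K S hS => ?_
  have hle : Subgroup.closure (S ∩ K) ≤ K := (Subgroup.closure_le K).2 Set.inter_subset_right
  have hfg : (Subgroup.closure (S ∩ K)).FG := (Subgroup.fg_iff _).2 ⟨_, rfl, hS.inter_of_left _⟩
  have : Finite ↥(S \ K) := hS.sdiff
  choose L hL hKL hxL using fun s : ↥(S \ K) => hG _ hfg s fun h => s.2.2 (hle h)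
  have : (⨅ s, L s).FiniteIndex := Subgroup.finiteIndex_iInf hL
  refine ⟨⨅ s, L s, mem_isolatedSubgroups_of_finiteIndex _, fun s hs => ⟨fun h => ?_, fun h => ?_⟩⟩
  · by_contra hsK
    exact hxL ⟨s, hs, hsK⟩ (Subgroup.mem_iInf.1 h _)
  · exact Subgroup.mem_iInf.2 fun i => hKL i (Subgroup.subset_closure ⟨hs, h⟩)

theorem Subgroup.FG.map_hom {P : Type*} [Group P] {K : Subgroup G} (hK : K.FG) (f : G →* P) :
    (K.map f).FG := by
  obtain ⟨S, rfl, hS⟩ := (Subgroup.fg_iff K).1 hK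
  exact (Subgroup.fg_iff _).2 ⟨f '' S, (f.map_closure S).symm, hS.image f⟩

theorem Subgroup.finiteIndex_comap {P : Type*} [Group P] (L : Subgroup P) [L.FiniteIndex]
    (f : G →* P) : (L.comap f).FiniteIndex :=
  ⟨by
    rw [Subgroup.index_comap]
    exact Subgroup.FiniteIndex.index_ne_zero⟩

theorem IsLERF.of_injective {P : Type*} [Group P] (hP : IsLERF P) (f : G →* P)
    (hf : Function.Injective f) : IsLERF G := by
  rw [isLERF_iff_forall_notMem] at hP ⊢
  intro K hK x hx
  obtain ⟨L, hL, hKL, hxL⟩ := hP (K.map f) (Subgroup.FG.map_hom hK f) (f x)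
    fun h => hx ((Subgroup.mem_map_iff_mem hf).1 h)
  exact ⟨L.comap f, Subgroup.finiteIndex_comap L f, Subgroup.map_le_iff_le_comap.1 hKL, hxL⟩

/-- The subgroup axioms are closed conditions on indicator functions, so the image in `{0,1}^G` is
closed. -/
instance : CompactSpace (Subgroup G) := by
  classical
  let F : Subgroup G → G → Bool := fun K g => decide (g ∈ K)
  have hF : Topology.IsInducing F := by
    refine ⟨?_⟩
    rw [chabautyTopology]
  refine hF.isCompact_iff.2 ?_ |> isCompact_univ_iff.1
  rw [Set.image_univ]
  have : Set.range F = {f | f 1 = true} ∩ (⋂ a, {f | f a = true → f a⁻¹ = true}) ∩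
      ⋂ a, ⋂ b, {f | f a = true → f b = true → f (a * b) = true} := by
    ext f
    constructor
    · rintro ⟨K, rfl⟩
      simp only [F, Set.mem_inter_iff, Set.mem_iInter, Set.mem_ofPred_eq, decide_eq_true_eq]
      exact ⟨⟨K.one_mem, fun a => K.inv_mem⟩, fun a b => K.mul_mem⟩
    · simp only [Set.mem_inter_iff, Set.mem_iInter, Set.mem_ofPred_eq]
      rintro ⟨⟨h1, hi⟩, hm⟩
      exact ⟨{ carrier := {g | f g = true}, one_mem' := h1, inv_mem' := hi _,
               mul_mem' := hm _ _ }, by ext g; simp [F]⟩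
  rw [this]
  have hcl : ∀ a : G, IsClopen {f : G → Bool | f a = true} := fun a =>
    (isClopen_discrete {true}).preimage (continuous_apply a)
  refine IsClosed.isCompact ((IsClosed.inter (hcl 1).1 (isClosed_iInter fun a => ?_)).inter
    (isClosed_iInter fun a => isClosed_iInter fun b => ?_))
  · exact isClosed_imp (hcl a).2 (hcl _).1
  · exact isClosed_imp (hcl a).2 (isClosed_imp (hcl b).2 (hcl _).1)

instance : T2Space (Subgroup G) := by
  refine ⟨fun K L hKL => ?_⟩
  obtain ⟨g, hg⟩ : ∃ g, ¬(g ∈ K ↔ g ∈ L) := by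
    by_contra! h
    exact hKL (Subgroup.ext h)
  refine ⟨_, _, isOpen_setOf_agreeOn (Set.finite_singleton g) K,
    isOpen_setOf_agreeOn (Set.finite_singleton g) L, fun _ _ => Iff.rfl, fun _ _ => Iff.rfl, ?_⟩
  rw [Set.disjoint_left]
  intro M hM hM'
  exact hg ((hM g rfl).symm.trans (hM' g rfl))

/-- By Baire, removing the countably many non-isolated points, each with dense open complement,
leaves a dense set. -/
theorem isSolitary_of_countable [Countable (Subgroup G)] : IsSolitary G := by
  have h := dense_biInter_of_isOpen (S := (isolatedSubgroups G)ᶜ)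
    (f := fun K => ({K}ᶜ : Set (Subgroup G))) (fun K _ => isOpen_compl_singleton)
    (Set.to_countable _) fun K hK => dense_compl_singleton_iff_not_open.2 hK
  refine h.mono fun K hK => ?_
  by_contra hK'
  exact Set.mem_iInter₂.1 hK K hK' rfl

theorem IsSolitary.of_surjective {H : Type*} [Group H] (hH : IsSolitary H) (p : H →* G)
    (hp : Function.Surjective p) (hker : p.ker.FG) : IsSolitary G := by
  rw [isSolitary_iff_agreeOn] at hH ⊢
  intro K S hS
  obtain ⟨T, hT, hTfin⟩ := (Subgroup.fg_iff _).1 hker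
  -- Including generators of the kernel forces `p.ker ≤ M`, so `M` is the full preimage of its
  -- image.
  obtain ⟨M, hM, hMK⟩ := hH (K.comap p) (Function.surjInv hp '' S ∪ T) ((hS.image _).union hTfin)
  have hkM : p.ker ≤ M := by
    rw [← hT, Subgroup.closure_le]
    intro t ht
    have : t ∈ p.ker := hT ▸ Subgroup.subset_closure ht
    refine (hMK t (Or.inr ht)).2 ?_
    rw [Subgroup.mem_comap, MonoidHom.mem_ker.1 this]
    exact K.one_mem
  have hcm : (M.map p).comap p = M := Subgroup.comap_map_eq_self hkM
  refine ⟨M.map p, ?_, fun s hs => ?_⟩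
  · obtain ⟨U, hU, hUM⟩ := mem_isolatedSubgroups_iff.1 hM
    refine mem_isolatedSubgroups_iff.2 ⟨p '' U, hU.image _, fun L hL => ?_⟩
    rw [← hUM (L.comap p) fun u hu => ?_, Subgroup.map_comap_eq_self_of_surjective hp]
    rw [Subgroup.mem_comap, hL _ ⟨u, hu, rfl⟩, ← Subgroup.mem_comap, hcm]
  · have h := hMK _ (Or.inl ⟨s, hs, rfl⟩)
    rw [Subgroup.mem_comap, Function.surjInv_eq hp] at h
    rw [← h]
    conv_rhs => rw [← hcm]
    rw [Subgroup.mem_comap, Function.surjInv_eq hp]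

theorem IsSolitary.of_bijective {H : Type*} [Group H] (hH : IsSolitary H) (p : H →* G)
    (hp : Function.Bijective p) : IsSolitary G :=
  hH.of_surjective p hp.2 <| by
    rw [(MonoidHom.ker_eq_bot_iff p).2 hp.1]
    exact Subgroup.FG.bot

end Chabauty

/-! ### Finite tracking data for words in two actions. -/

section PartialEquivariant

open Equiv Monoid Coprod

variable {G X X' : Type*} [Group G]

/-- The map `ι` respects the relations `α g y = z` with `g ∈ S` and `y, z ∈ Y`. -/
def PartialEquivariant (S : Set G) (Y : Set X) (α : G →* Perm X) (a : G →* Perm X')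
    (ι : X → X') : Prop :=
  ∀ g ∈ S, ∀ y ∈ Y, α g y ∈ Y → a g (ι y) = ι (α g y)

theorem PartialEquivariant.mono {S T : Set G} {Y Z : Set X} {α : G →* Perm X}
    {a : G →* Perm X'} {ι : X → X'} (h : PartialEquivariant T Z α a ι) (hS : S ⊆ T) (hY : Y ⊆ Z) :
    PartialEquivariant S Y α a ι :=
  fun g hg y hy hgy => h g (hS hg) y (hY hy) (hY hgy)

/-- Finite tracking data for a word `w` at a point `x`: any map respecting the relations in it
commutes with `w` at `x`. -/
theorem exists_finite_lift_apply_eq {H : Type*} [Group H] (α : G →* Perm X) (β : H →* Perm X)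
    (x : X) (w : Coprod G H) :
    ∃ (Y : Set X) (S : Set G) (T : Set H), Y.Finite ∧ S.Finite ∧ T.Finite ∧ x ∈ Y ∧
      lift α β w x ∈ Y ∧
      ∀ (X' : Type w) (a : G →* Perm X') (b : H →* Perm X') (ι : X → X'),
        PartialEquivariant S Y α a ι → PartialEquivariant T Y β b ι →
          lift a b w (ι x) = ι (lift α β w x) := by
  induction w using Coprod.induction_on' with
  | one => exact ⟨{x}, ∅, ∅, by simp, by simp, by simp, by simp, by simp, by simp⟩
  | inl_mul g w ih =>
    obtain ⟨Y, S, T, hY, hS, hT, hx, hw, h⟩ := ih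
    refine ⟨insert (lift α β (inl g * w) x) Y, insert g S, T, hY.insert _, hS.insert _, hT,
      Or.inr hx, Or.inl rfl, fun X' a b ι ha hb => ?_⟩
    have := h X' a b ι (ha.mono (Set.subset_insert _ _) (Set.subset_insert _ _))
      (hb.mono subset_rfl (Set.subset_insert _ _))
    simp only [map_mul, lift_apply_inl, Perm.mul_apply] at ha ⊢
    rw [this]
    exact ha g (Or.inl rfl) _ (Or.inr hw) (Or.inl rfl)
  | inr_mul g w ih =>
    obtain ⟨Y, S, T, hY, hS, hT, hx, hw, h⟩ := ih
    refine ⟨insert (lift α β (inr g * w) x) Y, S, insert g T, hY.insert _, hS, hT.insert _,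
      Or.inr hx, Or.inl rfl, fun X' a b ι ha hb => ?_⟩
    have := h X' a b ι (ha.mono subset_rfl (Set.subset_insert _ _))
      (hb.mono (Set.subset_insert _ _) (Set.subset_insert _ _))
    simp only [map_mul, lift_apply_inr, Perm.mul_apply] at hb ⊢
    rw [this]
    exact hb g (Or.inl rfl) _ (Or.inr hw) (Or.inl rfl)

theorem exists_finite_forall_lift_apply_eq {H : Type*} [Group H] (α : G →* Perm X)
    (β : H →* Perm X) (x : X) {W : Set (Coprod G H)} (hW : W.Finite) :
    ∃ (Y : Set X) (S : Set G) (T : Set H), Y.Finite ∧ S.Finite ∧ T.Finite ∧ x ∈ Y ∧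
      (∀ w ∈ W, lift α β w x ∈ Y) ∧
      ∀ (X' : Type w) (a : G →* Perm X') (b : H →* Perm X') (ι : X → X'),
        PartialEquivariant S Y α a ι → PartialEquivariant T Y β b ι →
          ∀ w ∈ W, lift a b w (ι x) = ι (lift α β w x) := by
  choose Y S T hY hS hT hx hw h using exists_finite_lift_apply_eq.{w} α β x
  refine ⟨insert x (⋃ w ∈ W, Y w), ⋃ w ∈ W, S w, ⋃ w ∈ W, T w,
    (hW.biUnion fun w _ => hY w).insert _, hW.biUnion fun w _ => hS w, hW.biUnion fun w _ => hT w,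
    Or.inl rfl, fun w hwW => Or.inr (Set.mem_biUnion hwW (hw w)),
    fun X' a b ι ha hb w hwW => h w X' a b ι
      (ha.mono (Set.subset_biUnion_of_mem hwW)
        ((Set.subset_biUnion_of_mem hwW).trans (Set.subset_insert _ _)))
      (hb.mono (Set.subset_biUnion_of_mem hwW)
        ((Set.subset_biUnion_of_mem hwW).trans (Set.subset_insert _ _)))⟩

end PartialEquivariant

/-! ### Finite models of actions, and free products of LERF groups. -/

section LERF

open Equiv Monoid Coprod

/-- A pair of points of a `G`-set can be separated by a partially equivariant map to a finite
`G`-set. -/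
theorem IsLERF.exists_separating {G : Type u} {X : Type v} [Group G] (hG : IsLERF G)
    (α : G →* Perm X) {S : Set G} {Y : Set X} (hS : S.Finite) (hY : Y.Finite) {y z : X}
    (hyz : y ≠ z) :
    ∃ (A : Type u) (_ : Finite A) (a : G →* Perm A) (ι : X → A),
      ι y ≠ ι z ∧ PartialEquivariant S Y α a ι := by
  classical
  have ht' : ∀ x, ∃ g, (∃ g, α g y = x) → α g y = x := fun x => by
    by_cases hx : ∃ g, α g y = x
    · exact hx.imp fun g hg _ => hg
    · exact ⟨1, fun h => (hx h).elim⟩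
  choose t ht using ht'
  -- Schreier-type elements fixing `y`, where `t x` carries `y` to `x` in its orbit. LERF is applied
  -- to the group they generate, since the full stabilizer need not be finitely generated.
  let R : Set G := (fun p : G × X => (t (α p.1 p.2))⁻¹ * (p.1 * t p.2)) ''
    (S ×ˢ (Y ∩ {x | ∃ g, α g y = x}))
  have hR : R.Finite := (hS.prod (hY.inter_of_left _)).image _
  have hfix : ∀ g ∈ Subgroup.closure R, α g y = y := by
    intro g hg
    have : Subgroup.closure R ≤ (MulAction.stabilizer (Perm X) y).comap α := by
      rw [Subgroup.closure_le]
      rintro _ ⟨⟨s, x⟩, ⟨hs, hx, g, hgx⟩, rfl⟩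
      have h1 := ht x ⟨g, hgx⟩
      have h2 := ht (α s x) ⟨s * g, by simp [hgx]⟩
      simp only [SetLike.mem_coe, Subgroup.mem_comap, MulAction.mem_stabilizer_iff, Perm.smul_def,
        map_mul, Perm.mul_apply, h1, map_inv]
      rw [Perm.inv_eq_iff_eq, h2]
    exact this hg
  obtain ⟨B, hB, hRB, hzB⟩ : ∃ B : Subgroup G, B.FiniteIndex ∧ Subgroup.closure R ≤ B ∧
      ((∃ g, α g y = z) → (t z)⁻¹ * t y ∉ B) := by
    by_cases hz : ∃ g, α g y = z
    · obtain ⟨B, h1, h2, h3⟩ := isLERF_iff_forall_notMem.1 hG (Subgroup.closure R)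
        ((Subgroup.fg_iff _).2 ⟨R, rfl, hR⟩) ((t z)⁻¹ * t y) fun h => by
          have := hfix _ h
          rw [map_mul, Perm.mul_apply, ht y ⟨1, by simp⟩, map_inv, Perm.inv_eq_iff_eq, ht z hz] at this
          exact hyz this
      exact ⟨B, h1, h2, fun _ => h3⟩
    · exact ⟨⊤, inferInstance, le_top, fun h => (hz h).elim⟩
  -- The fixed point `none` receives everything outside the orbit of `y`.
  refine ⟨Option (G ⧸ B), inferInstance, MulAction.toPermHom G _,
    fun x => if ∃ g, α g y = x then some (t x : G ⧸ B) else none, ?_, ?_⟩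
  · have hy : ∃ g, α g y = y := ⟨1, by simp⟩
    by_cases hz : ∃ g, α g y = z
    · simp only [if_pos hy, if_pos hz]
      intro h
      exact hzB hz (QuotientGroup.eq.1 (Option.some_injective _ h).symm)
    · simp only [if_pos hy, if_neg hz]
      exact Option.some_ne_none _
  · intro s hs x hx hsx
    simp only [MulAction.toPermHom_apply, MulAction.toPerm_apply]
    by_cases hxO : ∃ g, α g y = x
    · have hsO : ∃ g, α g y = α s x := hxO.imp' (s * ·) fun g hg => by simp [hg]
      rw [if_pos hxO, if_pos hsO, Option.smul_some, MulAction.Quotient.smul_coe]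
      exact congrArg some (QuotientGroup.eq.2
        (hRB (Subgroup.subset_closure ⟨(s, x), ⟨hs, hx, hxO⟩, rfl⟩))).symm
    · have hsO : ¬∃ g, α g y = α s x := fun ⟨g, hg⟩ => hxO ⟨s⁻¹ * g, by
        rw [map_mul, Perm.mul_apply, hg, map_inv, Perm.inv_eq_iff_eq]⟩
      rw [if_neg hxO, if_neg hsO, Option.smul_none]

/-- The diagonal action on a product of `G`-sets. -/
def piPermHom {G ι : Type*} {A : ι → Type*} [Group G] (a : ∀ i, G →* Perm (A i)) :
    G →* Perm (∀ i, A i) where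
  toFun g := Equiv.piCongrRight fun i => a i g
  map_one' := by ext; simp
  map_mul' g h := by ext; simp

theorem IsLERF.exists_finite_model {G : Type u} {X : Type v} [Group G] (hG : IsLERF G)
    (α : G →* Perm X) {S : Set G} {Y : Set X} (hS : S.Finite) (hY : Y.Finite) :
    ∃ (A : Type (max u v)) (_ : Finite A) (a : G →* Perm A) (ι : X → A),
      Set.InjOn ι Y ∧ PartialEquivariant S Y α a ι := by
  have : Finite Y := hY
  choose A hA a ι hι ha using fun p : {p : Y × Y // (p.1 : X) ≠ p.2} =>
    hG.exists_separating α hS hY p.2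
  refine ⟨∀ p, A p, inferInstance, piPermHom a, fun x p => ι p x, fun y hy z hz h => ?_,
    fun s hs y hy hsy => funext fun p => ha p s hs y hy hsy⟩
  by_contra hyz
  exact hι ⟨(⟨y, hy⟩, ⟨z, hz⟩), hyz⟩ (congrFun h _)

theorem exists_perm_eqOn {X A : Type*} [Finite A] {Y : Set X} {f g : X → A} (hf : Set.InjOn f Y)
    (hg : Set.InjOn g Y) : ∃ σ : Perm A, ∀ y ∈ Y, σ (f y) = g y := by
  classical
  have := Fintype.ofFinite A
  let e : {x // x ∈ f '' Y} ≃ {x // x ∈ g '' Y} :=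
    (Equiv.Set.imageOfInjOn f Y hf).symm.trans (Equiv.Set.imageOfInjOn g Y hg)
  refine ⟨e.extendSubtype, fun y hy => ?_⟩
  rw [e.extendSubtype_apply_of_mem _ ⟨y, hy, rfl⟩]
  have : (Equiv.Set.imageOfInjOn f Y hf).symm ⟨f y, ⟨y, hy, rfl⟩⟩ = ⟨y, hy⟩ := by
    rw [Equiv.symm_apply_eq]
    rfl
  simp only [e, Equiv.trans_apply, this]
  rfl

theorem lift_comp_inl_comp_inr {M N P : Type*} [Group M] [Group N] [Group P]
    (f : Coprod M N →* P) : lift (f.comp inl) (f.comp inr) = f :=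
  hom_ext (by simp) (by simp)

/-- Free products of LERF groups are LERF. -/
theorem IsLERF.coprod {G : Type u} {H : Type v} [Group G] [Group H] (hG : IsLERF G)
    (hH : IsLERF H) : IsLERF (Coprod G H) := by
  rw [isLERF_iff_forall_notMem]
  intro K hK w hw
  obtain ⟨W, rfl, hW⟩ := (Subgroup.fg_iff K).1 hK
  set K := Subgroup.closure W
  let π := MulAction.toPermHom (Coprod G H) (Coprod G H ⧸ K)
  have hπ : lift (π.comp inl) (π.comp inr) = π := lift_comp_inl_comp_inr π
  have hmem : ∀ v : Coprod G H, π v ((1 : Coprod G H) : Coprod G H ⧸ K) = (1 : Coprod G H) ↔ v ∈ K := by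
    intro v
    simp only [π, MulAction.toPermHom_apply, MulAction.toPerm_apply, MulAction.Quotient.smul_coe,
      smul_eq_mul, mul_one]
    rw [eq_comm, QuotientGroup.eq]
    simp
  obtain ⟨Y, S, T, hY, hS, hT, hx, hWY, h⟩ := exists_finite_forall_lift_apply_eq.{max u v}
    (π.comp inl) (π.comp inr) ((1 : Coprod G H) : Coprod G H ⧸ K) (hW.insert w)
  rw [hπ] at hWY h
  obtain ⟨A, _, a, ι, hι, ha⟩ := hG.exists_finite_model (π.comp inl) hS hY
  obtain ⟨B, _, b, κ, hκ, hb⟩ := hH.exists_finite_model (π.comp inr) hT hY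
  set x₀ : Coprod G H ⧸ K := ((1 : Coprod G H) : Coprod G H ⧸ K)
  -- Passing to `A × B` gives both models one underlying set; `σ` matches the two copies of `Y`, and
  -- conjugating the second action by it makes both actions extend the same partial picture.
  obtain ⟨σ, hσ⟩ := exists_perm_eqOn (A := A × B) (f := fun x => (ι x, κ x₀))
    (g := fun x => (ι x₀, κ x)) (fun y hy z hz hyz => hι hy hz (congrArg Prod.fst hyz))
    (fun y hy z hz hyz => hκ hy hz (congrArg Prod.snd hyz))
  let a' : G →* Perm (A × B) :=
    { toFun := fun g => Equiv.prodCongr (a g) (Equiv.refl B)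
      map_one' := by ext <;> simp
      map_mul' := fun g h => by ext <;> simp }
  let b₀ : H →* Perm (A × B) :=
    { toFun := fun g => Equiv.prodCongr (Equiv.refl A) (b g)
      map_one' := by ext <;> simp
      map_mul' := fun g h => by ext <;> simp }
  let b' : H →* Perm (A × B) := (MulAut.conj σ⁻¹).toMonoidHom.comp b₀
  have key := h (A × B) a' b' (fun x => (ι x, κ x₀))
    (fun s hs y hy hsy => Prod.ext (ha s hs y hy hsy) rfl)
    (fun s hs y hy hsy => by
      change σ⁻¹ (Equiv.prodCongr (Equiv.refl A) (b s) (σ (ι y, κ x₀))) = _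
      rw [hσ y hy, Perm.inv_eq_iff_eq, hσ _ hsy]
      exact Prod.ext rfl (hb s hs y hy hsy))
  refine ⟨(MulAction.stabilizer (Perm (A × B)) (ι x₀, κ x₀)).comap (lift a' b'),
    Subgroup.finiteIndex_comap _ _, ?_, fun hmw => ?_⟩
  · rw [Subgroup.closure_le]
    intro v hv
    have h1 := key v (Or.inr hv)
    rwa [(hmem v).2 (Subgroup.subset_closure hv)] at h1
  · have h1 := key w (Or.inl rfl)
    have h2 : lift a' b' w (ι x₀, κ x₀) = (ι x₀, κ x₀) := hmw
    rw [h2] at h1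
    exact hw ((hmem w).1 (hι hx (hWY w (Or.inl rfl)) (congrArg Prod.fst h1)).symm)

end LERF

/-! ### Rigid pairs of actions live on finite sets. -/

section Rigid

open Equiv Monoid Coprod

variable {G : Type u} {H : Type v} {X : Type (max u v)} [Group G] [Group H]

/-- A pair of actions on `X` is rigid at `x₀` relative to `Y` if every pair of actions in which the
partial actions on `Y` embed contains the orbit of `x₀` in `X`. -/
def IsRigidAt (α : G →* Perm X) (β : H →* Perm X) (x₀ : X) (Y : Set X) : Prop :=
  ∀ (X' : Type (max u v)) (a : G →* Perm X') (b : H →* Perm X') (ι : X → X'),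
    Function.Injective ι → PartialEquivariant Set.univ Y α a ι →
    PartialEquivariant Set.univ Y β b ι →
    ∃ s : X → X', Function.Injective s ∧ s x₀ = ι x₀ ∧ (∀ g x, s (α g x) = a g (s x)) ∧
      ∀ h x, s (β h x) = b h (s x)

theorem IsRigidAt.symm {α : G →* Perm X} {β : H →* Perm X} {x₀ : X} {Y : Set X}
    (hr : IsRigidAt α β x₀ Y) : IsRigidAt.{v, u} β α x₀ Y := fun X' b a ι hι hb ha => by
  obtain ⟨s, h1, h2, h3, h4⟩ := hr X' a b ι hι ha hb
  exact ⟨s, h1, h2, h4, h3⟩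

/-- Two actions are jointly transitive from `x₀`, as an induction principle. -/
def JointlyTransitive (α : G →* Perm X) (β : H →* Perm X) (x₀ : X) : Prop :=
  ∀ p : X → Prop, p x₀ → (∀ g x, p x → p (α g x)) → (∀ h x, p x → p (β h x)) → ∀ x, p x

theorem JointlyTransitive.symm {α : G →* Perm X} {β : H →* Perm X} {x₀ : X}
    (ht : JointlyTransitive α β x₀) : JointlyTransitive.{v, u} β α x₀ :=
  fun p h0 hb ha => ht p h0 ha hb

open Classical in
/-- The action obtained from `β` by making it trivial on the orbit of `o`. -/
noncomputable def trivializeOrbit (β : H →* Perm X) (o : X) : H →* Perm X :=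
  @MulAction.toPermHom H X _
    { smul := fun h x => if ∃ k, β k o = x then x else β h x
      one_smul := fun x => by
        change (if ∃ k, β k o = x then x else β 1 x) = x
        simp
      mul_smul := fun h k x => by
        change (if ∃ l, β l o = x then x else β (h * k) x) =
          if ∃ l, β l o = (if ∃ l, β l o = x then x else β k x)
          then (if ∃ l, β l o = x then x else β k x)
          else β h (if ∃ l, β l o = x then x else β k x)
        by_cases hx : ∃ l, β l o = x
        · simp only [if_pos hx]
        · have hkx : ¬∃ l, β l o = β k x := fun ⟨l, hl⟩ => hx ⟨k⁻¹ * l, by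
            rw [map_mul, Perm.mul_apply, hl, map_inv, Perm.inv_eq_iff_eq]⟩
          simp only [if_neg hx, if_neg hkx, map_mul, Perm.mul_apply] }

theorem trivializeOrbit_of_mem (β : H →* Perm X) {o x : X} (hx : ∃ k, β k o = x) (h : H) :
    trivializeOrbit β o h x = x :=
  if_pos hx

theorem trivializeOrbit_of_notMem (β : H →* Perm X) {o x : X} (hx : ¬∃ k, β k o = x) (h : H) :
    trivializeOrbit β o h x = β h x :=
  if_neg hx

open Classical in
/-- The action on `X × H` covering `β`, where `H` acts by translations over the fixed point `o`. -/
noncomputable def translateOver (β : H →* Perm X) (o : X) (ho : ∀ h, β h o = o) :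
    H →* Perm (X × H) :=
  @MulAction.toPermHom H (X × H) _
    { smul := fun h x => (β h x.1, if x.1 = o then h * x.2 else x.2)
      one_smul := fun x => by
        change (β 1 x.1, if x.1 = o then 1 * x.2 else x.2) = x
        simp
      mul_smul := fun h k x => by
        change (β (h * k) x.1, if x.1 = o then h * k * x.2 else x.2) =
          (β h (β k x.1), if β k x.1 = o then h * (if x.1 = o then k * x.2 else x.2)
            else if x.1 = o then k * x.2 else x.2)
        by_cases hx : x.1 = o
        · simp [hx, ho, mul_assoc]
        · have : β k x.1 ≠ o := fun h => hx ((β k).injective (h.trans (ho k).symm))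
          simp [hx, this] }

theorem translateOver_apply_self (β : H →* Perm X) {o : X} (ho : ∀ h, β h o = o) (h k : H) :
    translateOver β o ho h (o, k) = (o, h * k) :=
  Prod.ext (ho h) (if_pos rfl)

theorem translateOver_apply_of_ne (β : H →* Perm X) {o x : X} (ho : ∀ h, β h o = o) (hx : x ≠ o)
    (h k : H) : translateOver β o ho h (x, k) = (β h x, k) :=
  Prod.ext rfl (if_neg hx)

/-- The action on `X × Z` through the first factor. -/
def fstPermHom {K X : Type*} [Group K] (α : K →* Perm X) (Z : Type*) : K →* Perm (X × Z) where
  toFun g := Equiv.prodCongr (α g) (Equiv.refl Z)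
  map_one' := by ext <;> simp
  map_mul' g h := by ext <;> simp

theorem fstPermHom_apply {K X : Type*} [Group K] (α : K →* Perm X) (Z : Type*) (g : K)
    (x : X × Z) : fstPermHom α Z g x = (α g x.1, x.2) :=
  rfl

variable {α : G →* Perm X} {β : H →* Perm X} {x₀ : X} {Y : Set X}

/-- An orbit missing `Y` can be altered freely. Trivializing it yields a point fixed by `H`;
replacing that point by a free `H`-orbit in a cover then contradicts rigidity. -/
theorem IsRigidAt.forall_orbit_inter_nonempty [Nontrivial H] (hr : IsRigidAt α β x₀ Y)
    (ht : JointlyTransitive α β x₀) (o : X) : ∃ h, β h o ∈ Y := by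
  by_contra! hO
  obtain ⟨s, hs, hs0, hsa, hsb⟩ := hr X α (trivializeOrbit β o) id Function.injective_id
    (fun _ _ _ _ _ => rfl) fun h _ y hy _ =>
      trivializeOrbit_of_notMem β (fun ⟨k, hk⟩ => hO k (hk ▸ hy)) h
  -- Otherwise the points fixed by `s` all avoid the altered orbit, and joint transitivity makes `s`
  -- the identity everywhere.
  obtain ⟨k, hk⟩ : ∃ k, s (β k o) = β k o := by
    by_contra! h
    refine h 1 (ht (fun x => s x = x) hs0 (fun g x hx => ?_) (fun l x hx => ?_) _)
    · rw [hsa, hx]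
    · rw [hsb, hx]
      exact trivializeOrbit_of_notMem β (fun ⟨k, hk⟩ => h k (hk ▸ hx)) l
  set o' := β k o
  have ho' : ∀ h, β h o' = o' := fun h => hs <| by
    rw [hsb, hk]
    exact trivializeOrbit_of_mem β ⟨k, rfl⟩ h
  have hoY : ∀ y ∈ Y, y ≠ o' := fun y hy hyo => hO k (by rwa [hyo] at hy)
  obtain ⟨f, -, hf0, hfa, hfb⟩ := hr (X × H) (fstPermHom α H) (translateOver β o' ho')
    (fun x => (x, 1)) (fun x y h => congrArg Prod.fst h) (fun _ _ _ _ _ => rfl)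
    fun h _ y hy _ => translateOver_apply_of_ne β ho' (hoY y hy) h 1
  have hf : ∀ x, (f x).1 = x := by
    refine ht _ (by rw [hf0]) (fun g x hx => ?_) fun h x hx => ?_
    · rw [hfa, fstPermHom_apply, hx]
    · rw [hfb]
      change β h (f x).1 = _
      rw [hx]
  obtain ⟨h, hh⟩ := exists_ne (1 : H)
  have h1 := hfb h o'
  have h2 : f o' = (o', (f o').2) := Prod.ext (hf o') rfl
  rw [ho', h2, translateOver_apply_self] at h1
  exact hh (right_eq_mul.1 (congrArg Prod.snd h1))

theorem finite_setOf_invariant {K X Z : Type*} [Group K] [Finite Z] (γ : K →* Perm X) {Y : Set X}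
    (hY : Y.Finite) (hO : ∀ x, ∃ k, γ k x ∈ Y) :
    {f : X → Z | ∀ k x, f (γ k x) = f x}.Finite := by
  have : Finite Y := hY
  refine Set.Finite.of_finite_image (f := fun f (y : Y) => f y) (Set.toFinite _) ?_
  intro f hf g hg hfg
  funext x
  obtain ⟨k, hk⟩ := hO x
  rw [← hf k x, ← hg k x]
  exact congrFun hfg ⟨_, hk⟩

/-- For each `x₁ ∉ Y`, a double cover twisted at `x₁` has an equivariant section. It gives an
`α`-invariant Boolean function whose sum with the indicator of `x₁` is `β`-invariant. The pair
determines `x₁`, and only finitely many pairs exist because every orbit meets the finite set `Y`. -/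
theorem IsRigidAt.finite [Nontrivial G] [Nontrivial H] (hr : IsRigidAt α β x₀ Y)
    (ht : JointlyTransitive α β x₀) (hY : Y.Finite) : Finite X := by
  classical
  have hα := finite_setOf_invariant (Z := Bool) α hY (hr.symm.forall_orbit_inter_nonempty ht.symm)
  have hβ := finite_setOf_invariant (Z := Bool) β hY (hr.forall_orbit_inter_nonempty ht)
  have key : ∀ x₁ ∉ Y, ∃ f : X → Bool, (∀ g x, f (α g x) = f x) ∧
      ∀ h x, xor (f (β h x)) (decide (β h x = x₁)) = xor (f x) (decide (x = x₁)) := by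
    intro x₁ hx₁
    let τ : Perm (X × Bool) := Function.Involutive.toPerm
      (fun p => (p.1, xor p.2 (decide (p.1 = x₁)))) fun p => by ext <;> simp
    have hτ : ∀ p, τ p = (p.1, xor p.2 (decide (p.1 = x₁))) := fun _ => rfl
    have hτ' : ∀ p, τ⁻¹ p = (p.1, xor p.2 (decide (p.1 = x₁))) := fun _ => rfl
    have hne : ∀ y ∈ Y, y ≠ x₁ := fun y hy h => hx₁ (h ▸ hy)
    let b : H →* Perm (X × Bool) := (MulAut.conj τ⁻¹).toMonoidHom.comp (fstPermHom β Bool)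
    have hb : ∀ h p, b h p = τ⁻¹ (fstPermHom β Bool h (τ p)) := fun _ _ => rfl
    obtain ⟨s, -, hs0, hsa, hsb⟩ := hr (X × Bool) (fstPermHom α Bool) b
      (fun x => (x, false)) (fun x y h => congrArg Prod.fst h) (fun _ _ _ _ _ => rfl)
      fun h _ y hy hhy => by
        rw [hb, hτ, fstPermHom_apply, hτ']
        simp [hne y hy, hne _ hhy]
    have hs : ∀ x, (s x).1 = x := by
      refine ht _ (by rw [hs0]) (fun g x hx => ?_) fun h x hx => ?_
      · rw [hsa, fstPermHom_apply, hx]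
      · rw [hsb, hb, hτ', fstPermHom_apply, hτ, hx]
    refine ⟨fun x => (s x).2, fun g x => ?_, fun h x => ?_⟩
    · simp only [hsa, fstPermHom_apply]
    · simp only [hsb, hb, hτ', fstPermHom_apply, hτ, hs]
      simp
  choose! f hfα hfβ using key
  have hinj : Set.InjOn (fun x₁ => (f x₁, fun x => xor (f x₁ x) (decide (x = x₁)))) Yᶜ := by
    intro x₁ _ x₂ _ h
    have h1 : f x₁ = f x₂ := congrArg Prod.fst h
    have h2 := congrFun (congrArg Prod.snd h) x₁
    by_contra hne
    simp [h1, hne] at h2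
  have hfin : Yᶜ.Finite := Set.Finite.of_finite_image
    ((hα.prod hβ).subset (by
      rintro _ ⟨x₁, hx₁, rfl⟩
      exact ⟨hfα x₁ hx₁, hfβ x₁ hx₁⟩)) hinj
  exact Set.finite_univ_iff.1 (Set.union_compl_self Y ▸ hY.union hfin)

end Rigid

/-! ### Isolated subgroups of free products and the characterization. -/

section Coprod

open Equiv Monoid Coprod

variable {G : Type u} {H : Type v} [Group G] [Group H]

/-- If the partial coset actions on `Y` embed in another pair of actions, the stabilizer of the
image of the base point agrees with `K` on `W`, hence equals `K`. Its orbit is therefore a copy of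
the coset space, which is rigidity. -/
theorem finiteIndex_of_mem_isolatedSubgroups_coprod [Nontrivial G] [Nontrivial H]
    {K : Subgroup (Coprod G H)} (hK : K ∈ isolatedSubgroups (Coprod G H)) : K.FiniteIndex := by
  obtain ⟨W, hW, hKW⟩ := mem_isolatedSubgroups_iff.1 hK
  let π := MulAction.toPermHom (Coprod G H) (Coprod G H ⧸ K)
  have hπ : lift (π.comp inl) (π.comp inr) = π := lift_comp_inl_comp_inr π
  let x₀ : Coprod G H ⧸ K := ((1 : Coprod G H) : Coprod G H ⧸ K)
  have hx₀ : ∀ v : Coprod G H, π v x₀ = (v : Coprod G H ⧸ K) := fun v =>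
    congrArg _ (mul_one v)
  have hmem : ∀ v : Coprod G H, π v x₀ = x₀ ↔ v ∈ K := by
    intro v
    rw [hx₀, eq_comm, QuotientGroup.eq]
    simp
  obtain ⟨Y, S, T, hY, -, -, -, -, h⟩ := exists_finite_forall_lift_apply_eq.{max u v}
    (π.comp inl) (π.comp inr) x₀ hW
  rw [hπ] at h
  have hr : IsRigidAt (π.comp inl) (π.comp inr) x₀ Y := by
    intro X' a b ι hι ha hb
    have key := h X' a b ι (ha.mono (Set.subset_univ _) subset_rfl)
      (hb.mono (Set.subset_univ _) subset_rfl)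
    have hL := hKW ((MulAction.stabilizer (Perm X') (ι x₀)).comap (lift a b)) fun w hw => by
      rw [← hmem, ← hι.eq_iff, ← key w hw]
      rfl
    have hL' : ∀ w, lift a b w (ι x₀) = ι x₀ ↔ w ∈ K := fun w => by
      conv_rhs => rw [← hL]
      rfl
    have hcos : ∀ v w : Coprod G H, lift a b v (ι x₀) = lift a b w (ι x₀) ↔
        (v : Coprod G H ⧸ K) = w := fun v w => by
      rw [QuotientGroup.eq, ← hL', map_mul, Perm.mul_apply, map_inv, Perm.inv_eq_iff_eq, eq_comm]
    have hs : ∀ v : Coprod G H, lift a b (Quotient.out (v : Coprod G H ⧸ K)) (ι x₀) =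
        lift a b v (ι x₀) := fun v => (hcos _ _).2 (QuotientGroup.out_eq' _)
    have hcomm : ∀ u (x : Coprod G H ⧸ K), lift a b (Quotient.out (π u x)) (ι x₀) =
        lift a b u (lift a b (Quotient.out x) (ι x₀)) := by
      intro u x
      induction x using QuotientGroup.induction_on with
      | H v =>
        rw [hs v]
        change lift a b (Quotient.out ((u * v : Coprod G H) : Coprod G H ⧸ K)) (ι x₀) = _
        rw [hs, map_mul, Perm.mul_apply]
    refine ⟨fun x => lift a b (Quotient.out x) (ι x₀), fun x y hxy => ?_, ?_,
      fun g x => hcomm (inl g) x, fun g x => hcomm (inr g) x⟩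
    · rw [← QuotientGroup.out_eq' x, ← QuotientGroup.out_eq' y]
      exact (hcos _ _).1 hxy
    · change lift a b (Quotient.out ((1 : Coprod G H) : Coprod G H ⧸ K)) (ι x₀) = _
      rw [hs, map_one, Perm.one_apply]
  have ht : JointlyTransitive (π.comp inl) (π.comp inr) x₀ := by
    intro p h0 hp hq x
    induction x using QuotientGroup.induction_on with
    | H v =>
      rw [← hx₀]
      induction v using Coprod.induction_on' with
      | one => simpa using h0
      | inl_mul g w ih =>
        rw [map_mul]
        exact hp g _ ih
      | inr_mul g w ih =>
        rw [map_mul]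
        exact hq g _ ih
  have := hr.finite ht hY
  exact Subgroup.finiteIndex_of_finite_quotient

theorem Group.fg_of_finiteIndex {K : Subgroup G} [K.FiniteIndex] (hK : K.FG) : Group.FG G := by
  obtain ⟨T, rfl, hT⟩ := (Subgroup.fg_iff K).1 hK
  set K := Subgroup.closure T
  refine Group.fg_iff.2 ⟨T ∪ Set.range (Quotient.out : G ⧸ K → G), eq_top_iff.2 fun g _ => ?_,
    hT.union (@Set.finite_range _ _ _ (inferInstanceAs (Finite (G ⧸ K))))⟩
  have h1 : (Quotient.out (g : G ⧸ K))⁻¹ * g ∈ K :=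
    QuotientGroup.eq.1 (QuotientGroup.out_eq' (g : G ⧸ K))
  have h2 : Quotient.out (g : G ⧸ K) ∈ Subgroup.closure
      (T ∪ Set.range (Quotient.out : G ⧸ K → G)) := Subgroup.subset_closure (Or.inr ⟨_, rfl⟩)
  simpa using Subgroup.mul_mem _ h2 (Subgroup.closure_mono Set.subset_union_left h1)

theorem IsSolitary.fg_and_isLERF_coprod [Nontrivial G] [Nontrivial H]
    (h : IsSolitary (Coprod G H)) : Group.FG (Coprod G H) ∧ IsLERF (Coprod G H) := by
  rw [isSolitary_iff_agreeOn] at h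
  constructor
  · obtain ⟨L, hL, -⟩ := h ⊥ ∅ Set.finite_empty
    have := finiteIndex_of_mem_isolatedSubgroups_coprod hL
    exact Group.fg_of_finiteIndex (fg_of_mem_isolatedSubgroups hL)
  · refine isLERF_iff_forall_notMem.2 fun K hK x hx => ?_
    obtain ⟨W, rfl, hW⟩ := (Subgroup.fg_iff K).1 hK
    obtain ⟨L, hL, hLK⟩ := h _ _ (hW.insert x)
    refine ⟨L, finiteIndex_of_mem_isolatedSubgroups_coprod hL, ?_,
      fun hxL => hx ((hLK x (Or.inl rfl)).1 hxL)⟩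
    rw [Subgroup.closure_le]
    exact fun w hw => (hLK w (Or.inr hw)).2 (Subgroup.subset_closure hw)

theorem isSolitary_coprod_iff_of_subsingleton_right [Subsingleton H] :
    IsSolitary (Coprod G H) ↔ IsSolitary G := by
  have h1 : (inl : G →* Coprod G H).comp fst = MonoidHom.id _ :=
    hom_ext (by ext; simp) (by
      ext h
      simp [Subsingleton.elim h 1])
  have h2 : ∀ w : Coprod G H, inl (fst w) = w := fun w => DFunLike.congr_fun h1 w
  exact ⟨fun h => h.of_bijective fst ⟨Function.LeftInverse.injective h2, fst_surjective⟩,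
    fun h => h.of_bijective inl ⟨inl_injective, fun w => ⟨_, h2 w⟩⟩⟩

theorem isSolitary_coprod_comm : IsSolitary (Coprod G H) ↔ IsSolitary (Coprod H G) :=
  ⟨fun h => h.of_bijective (MulEquiv.coprodComm G H).toMonoidHom (MulEquiv.bijective _),
    fun h => h.of_bijective (MulEquiv.coprodComm H G).toMonoidHom (MulEquiv.bijective _)⟩

theorem isSolitary_coprod_iff : IsSolitary (Coprod G H) ↔
    ((IsLERF G ∧ Group.FG G) ∧ (IsLERF H ∧ Group.FG H)) ∨
      ((IsSolitary G ∧ Subsingleton H) ∨ (IsSolitary H ∧ Subsingleton G)) := by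
  constructor
  · intro h
    rcases subsingleton_or_nontrivial H with hH | hH
    · exact Or.inr (Or.inl ⟨isSolitary_coprod_iff_of_subsingleton_right.1 h, hH⟩)
    rcases subsingleton_or_nontrivial G with hG | hG
    · exact Or.inr (Or.inr
        ⟨isSolitary_coprod_iff_of_subsingleton_right.1 (isSolitary_coprod_comm.1 h), hG⟩)
    obtain ⟨hfg, hL⟩ := h.fg_and_isLERF_coprod
    exact Or.inl ⟨⟨hL.of_injective inl inl_injective, Group.fg_of_surjective (f := (fst : Coprod G H →* G)) fst_surjective⟩,
      ⟨hL.of_injective inr inr_injective, Group.fg_of_surjective (f := (snd : Coprod G H →* H)) snd_surjective⟩⟩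
  · rintro (⟨⟨hG, hGfg⟩, hH, hHfg⟩ | ⟨hG, hH⟩ | ⟨hH, hG⟩)
    · have : Group.FG (Coprod G H) := by
        rw [Group.fg_def, ← range_inl_sup_range_inr]
        exact ((Group.fg_iff_subgroup_fg _).1 inferInstance).sup
          ((Group.fg_iff_subgroup_fg _).1 inferInstance)
      exact (hG.coprod hH).isSolitary
    · exact isSolitary_coprod_iff_of_subsingleton_right.2 hG
    · exact isSolitary_coprod_comm.2 (isSolitary_coprod_iff_of_subsingleton_right.2 hH)

end Coprod

theorem theorem1p5 :
    -- finitely generated LERF groups are solitary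
    (∀ (G : Type u) [Group G], Group.FG G → IsLERF G → IsSolitary G) ∧
    -- groups with countably many subgroups are solitary
    (∀ (G : Type u) [Group G], Countable (Subgroup G) → IsSolitary G) ∧
    -- quotients of solitary groups by finitely generated normal subgroups are solitary
    (∀ (N : Type u) (H : Type v) (G : Type w) [Group N] [Group H] [Group G]
      [Countable N] [Countable H] [Countable G] (i : N →* H) (p : H →* G),
      Function.Injective i → i.range = p.ker → Function.Surjective p →
      Group.FG N → IsSolitary H → IsSolitary G) ∧
    -- characterization of solitary free products
    (∀ (G : Type u) (H : Type v) [Group G] [Group H] [Countable G] [Countable H],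
      IsSolitary (Monoid.Coprod G H) ↔
        ((IsLERF G ∧ Group.FG G) ∧ (IsLERF H ∧ Group.FG H)) ∨
        ((IsSolitary G ∧ Subsingleton H) ∨ (IsSolitary H ∧ Subsingleton G))) := by
  refine ⟨fun G _ _ hG => hG.isSolitary, fun G _ _ => isSolitary_of_countable, ?_,
    fun G H _ _ _ _ => isSolitary_coprod_iff⟩
  intro N H G _ _ _ _ _ _ i p _ hip hp hN hH
  exact hH.of_surjective p hp (hip ▸ (Group.fg_iff_subgroup_fg _).1 inferInstance)
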